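/- A skew left brace is a triple $(A,+,\circ)$ in which $(A,+)$ and $(A,\circ)$ are (not necessarily abelian) groups on the same set such that $a\circ(b+c)=a\circ b-a+a\circ c$ for all $a,b,c\in A$. Let $\lambda\colon(A,\circ)\to\operatorname{Aut}(A,+)$ be the group homomorphism $\lambda_a(b)=-a+a\circ b$, and put $a*b=\lambda_a(b)-b$. The left series of $A$ is defined by $A^1=A$ and, for $n\ge 1$, $A^{n+1}=A*A^n$, the subgroup of $(A,+)$ generated by all $a*x$ with $a\in A$ and $x\in A^n$; the skew left brace $A$ is left nilpotent if $A^n=0$ for some $n\ge 1$. A group is locally nilpotent if each of its finitely generated subgroups is nilpotent. Theorem. Let $A$ be a left nilpotent skew left brace. Then: 1. the additive group of $A^2$ is locally nilpotent; 2. the multiplicative group of $A/\ker\lambda$, that is, the quotient group $(A,\circ)/\ker\lambda$, is locally nilpotent. -/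

import Mathlib

/-- A skew left brace `(A, +, ∘)`. Both groups may be non-abelian. The circle operation `∘` is
written `*` in Lean (so `a⁻¹` is the inverse for `∘`), and the axiom reads
`a ∘ (b + c) = a ∘ b - a + a ∘ c`. -/
class SkewLeftBrace (A : Type*) extends AddGroup A, Group A where
  mul_add_brace : ∀ a b c : A, a * (b + c) = a * b - a + a * c

namespace SkewLeftBrace

section

variable (A : Type*) [SkewLeftBrace A]

theorem lam_mul_aux (a b c : A) : -(a * b) + a * b * c = -a + a * (-b + b * c) := by
  have h := mul_add_brace a b (-b + b * c)
  rw [add_neg_cancel_left] at h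
  rw [mul_assoc, h, sub_eq_add_neg, add_assoc, neg_add_cancel_left]

theorem lam_one_aux (b : A) : -(1 : A) + 1 * b = b := by
  have h := mul_add_brace (1 : A) 0 0
  have h1 : (1 : A) = 0 := by simpa using h
  rw [one_mul, h1, neg_zero, zero_add]

variable {A}

/-- The automorphism `λ_a` of `(A, +)`, `λ_a (b) = -a + a ∘ b`. -/
def lamAut (a : A) : AddAut A where
  toFun b := -a + a * b
  invFun b := -a⁻¹ + a⁻¹ * b
  left_inv b := by
    beta_reduce
    rw [← lam_mul_aux, inv_mul_cancel, lam_one_aux]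
  right_inv b := by
    beta_reduce
    rw [← lam_mul_aux, mul_inv_cancel, lam_one_aux]
  map_add' b c := by
    rw [mul_add_brace, sub_eq_add_neg]
    simp only [add_assoc]

variable (A)

/-- The homomorphism `λ : (A, ∘) → Aut (A, +)`, `a ↦ λ_a`. Mathlib writes the automorphism group
`AddAut A` additively (its addition is composition), hence the `Multiplicative`. -/
def lam : A →* Multiplicative (AddAut A) :=
  MonoidHom.mk' (fun a => Multiplicative.ofAdd (lamAut a)) (fun a b => by
    apply Multiplicative.toAdd.injective
    apply AddEquiv.ext
    intro c
    exact lam_mul_aux A a b c)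

variable {A}

/-- The operation `a * b = λ_a (b) - b = -a + a ∘ b - b`. -/
def star (a b : A) : A := lamAut a b - b

/-- `X * Y`: the additive subgroup generated by all `x * y` with `x ∈ X`, `y ∈ Y`. -/
def starSpan (X Y : Set A) : AddSubgroup A :=
  AddSubgroup.closure {z | ∃ x ∈ X, ∃ y ∈ Y, z = star x y}

variable (A)

/-- The left series, indexed from zero: `leftSeries A n` is the term `A^{n+1}`, where `A^1 = A` and
`A^{n+1} = A * A^n`. -/
def leftSeries : ℕ → AddSubgroup A
  | 0 => ⊤
  | n + 1 => starSpan Set.univ (leftSeries n : Set A)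

/-- `A` is left nilpotent if some term of its left series is zero. -/
def IsLeftNilpotent : Prop := ∃ n : ℕ, leftSeries A n = ⊥

end

end SkewLeftBrace

/-- A group is locally nilpotent if all its finitely generated subgroups are nilpotent. -/
def IsLocallyNilpotentGroup (G : Type*) [Group G] : Prop :=
  ∀ H : Subgroup G, H.FG → Group.IsNilpotent H

/-- An additively written group is locally nilpotent if all its finitely generated subgroups are
nilpotent. -/
def IsLocallyNilpotentAddGroup (G : Type*) [AddGroup G] : Prop :=
  ∀ H : AddSubgroup G, H.FG → AddGroup.IsNilpotent H

/-! Inside the permutations of `A`, let `M` be the image of `λ` and `N` the left translations by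
`(A, +)`. Then `M` normalizes `N`, and the commutator of `λ_a` with translation by `x` is
translation by `a * x`; so the left series becomes `N`, `⁅M, N⁆`, `⁅M, ⁅M, N⁆⁆`, …, which reaches
the trivial group. By Hall's stability argument `M` is nilpotent modulo the centralizer of `N`, and
it meets that centralizer trivially because `λ_a` fixes `0`. Hence `M ≅ (A, ∘) / ker λ` is
nilpotent. For `A^2`, write `N_i` for the terms of the series, with `N_0 = N`. Climbing up from the
trivial term, `N_{i+1} M` is the join of the conjugates of `N_{i+2} M` by elements of `N_i`. These
conjugates normalize each other, so Hirsch–Plotkin carries local nilpotence up to `N_1 M`, which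
contains the translations by `A^2`. -/

open commutatorElement

namespace Subgroup

variable {G : Type*} [Group G]

/-! ### Fitting's theorem -/

/-- Centralizing `B` modulo `E` defines a subgroup, so bounds on commutators pass to joins. -/
theorem commutator_le_iff_le_comap_centralizer {A B E : Subgroup G} [E.Normal] :
    ⁅A, B⁆ ≤ E ↔
      A ≤ (centralizer (B.map (QuotientGroup.mk' E) : Set (G ⧸ E))).comap (QuotientGroup.mk' E) := by
  rw [← map_le_iff_le_comap, ← commutator_eq_bot_iff_le_centralizer, ← map_commutator, map_eq_bot_iff,
    QuotientGroup.ker_mk']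

theorem iSup_commutator_le {ι : Sort*} {A : ι → Subgroup G} {B E : Subgroup G} [E.Normal]
    (h : ∀ i, ⁅A i, B⁆ ≤ E) : ⁅⨆ i, A i, B⁆ ≤ E :=
  commutator_le_iff_le_comap_centralizer.2 <|
    iSup_le fun i => commutator_le_iff_le_comap_centralizer.1 (h i)

theorem commutator_sup_le {A B C E : Subgroup G} [E.Normal]
    (hB : ⁅A, B⁆ ≤ E) (hC : ⁅A, C⁆ ≤ E) : ⁅A, B ⊔ C⁆ ≤ E := by
  rw [commutator_comm] at *
  exact commutator_le_iff_le_comap_centralizer.2 <| sup_le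
    (commutator_le_iff_le_comap_centralizer.1 hB) (commutator_le_iff_le_comap_centralizer.1 hC)

/-- The lower central series of `P`, preceded by the whole group. -/
def extendedLowerCentralSeries (P : Subgroup G) : ℕ → Subgroup G
  | 0 => ⊤
  | n + 1 => P.lowerCentralSeries n

instance extendedLowerCentralSeries_normal (P : Subgroup G) [P.Normal] :
    ∀ n, (P.extendedLowerCentralSeries n).Normal
  | 0 => inferInstanceAs (⊤ : Subgroup G).Normal
  | n + 1 => inferInstanceAs (P.lowerCentralSeries n).Normal

theorem commutator_extendedLowerCentralSeries_le (P : Subgroup G) [P.Normal] (n : ℕ) :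
    ⁅P.extendedLowerCentralSeries n, P⁆ ≤ P.extendedLowerCentralSeries (n + 1) := by
  cases n with
  | zero => exact commutator_le_right _ _
  | succ n => exact le_rfl

/-- Each new commutator with `P ⊔ Q` raises either the `P`-weight or the `Q`-weight by one, while
normality keeps the other. -/
theorem lowerCentralSeries_sup_le (P Q : Subgroup G) [P.Normal] [Q.Normal] (n : ℕ) :
    (P ⊔ Q).lowerCentralSeries n ≤ ⨆ p : {p : ℕ × ℕ // p.1 + p.2 = n},
      P.extendedLowerCentralSeries p.1.1 ⊓ Q.extendedLowerCentralSeries p.1.2 := by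
  induction n with
  | zero =>
    refine le_trans ?_ (le_iSup _ ⟨(0, 0), rfl⟩)
    exact le_inf le_top le_top
  | succ n ih =>
    refine (commutator_mono ih le_rfl).trans (iSup_commutator_le ?_)
    rintro ⟨⟨i, j⟩, hij⟩
    dsimp only at hij ⊢
    have hle (p : {p : ℕ × ℕ // p.1 + p.2 = n + 1}) :=
      le_iSup (fun p : {p : ℕ × ℕ // p.1 + p.2 = n + 1} =>
        P.extendedLowerCentralSeries p.1.1 ⊓ Q.extendedLowerCentralSeries p.1.2) p
    refine commutator_sup_le ((le_inf ?_ ?_).trans (hle ⟨(i + 1, j), by omega⟩))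
      ((le_inf ?_ ?_).trans (hle ⟨(i, j + 1), by omega⟩))
    · exact (commutator_mono inf_le_left le_rfl).trans
        (commutator_extendedLowerCentralSeries_le P i)
    · exact (commutator_mono inf_le_right le_rfl).trans (commutator_le_left _ _)
    · exact (commutator_mono inf_le_left le_rfl).trans (commutator_le_left _ _)
    · exact (commutator_mono inf_le_right le_rfl).trans
        (commutator_extendedLowerCentralSeries_le Q j)

/-- **Fitting's theorem**, for normal subgroups. -/
theorem lowerCentralSeries_sup_eq_bot_of_normal {P Q : Subgroup G} [P.Normal] [Q.Normal]
    {c d : ℕ} (hP : P.lowerCentralSeries c = ⊥) (hQ : Q.lowerCentralSeries d = ⊥) :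
    (P ⊔ Q).lowerCentralSeries (c + d + 1) = ⊥ := by
  refine le_bot_iff.1 ((lowerCentralSeries_sup_le P Q _).trans (iSup_le ?_))
  rintro ⟨⟨i, j⟩, hij⟩
  dsimp only at hij ⊢
  -- As `i + j = c + d + 1`, either `i > c` or `j > d`; the strict inequality absorbs the shift in
  -- the extended series.
  rcases le_or_gt (c + 1) i with hi | hi
  · obtain ⟨k, rfl⟩ : ∃ k, i = k + 1 := ⟨i - 1, by omega⟩
    exact inf_le_left.trans ((P.lowerCentralSeries_antitone (by omega)).trans hP.le)
  · obtain ⟨k, rfl⟩ : ∃ k, j = k + 1 := ⟨j - 1, by omega⟩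
    exact inf_le_right.trans ((Q.lowerCentralSeries_antitone (by omega)).trans hQ.le)

/-- **Fitting's theorem**, for subgroups normalizing each other. -/
theorem exists_lowerCentralSeries_sup_eq_bot {P Q : Subgroup G}
    (hPQ : P ≤ normalizer Q) (hQP : Q ≤ normalizer P)
    (hP : ∃ c, P.lowerCentralSeries c = ⊥) (hQ : ∃ d, Q.lowerCentralSeries d = ⊥) :
    ∃ n, (P ⊔ Q).lowerCentralSeries n = ⊥ := by
  obtain ⟨c, hc⟩ := hP
  obtain ⟨d, hd⟩ := hQ
  have : (P.subgroupOf (P ⊔ Q)).Normal :=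
    normal_subgroupOf_of_le_normalizer (sup_le le_normalizer hQP)
  have : (Q.subgroupOf (P ⊔ Q)).Normal :=
    normal_subgroupOf_of_le_normalizer (sup_le hPQ le_normalizer)
  have key (R : Subgroup G) (hR : R ≤ P ⊔ Q) (n : ℕ) :
      ((R.subgroupOf (P ⊔ Q)).lowerCentralSeries n).map (P ⊔ Q).subtype =
        R.lowerCentralSeries n := by
    rw [map_lowerCentralSeries, subgroupOf_map_subtype, inf_eq_left.2 hR]
  have hinj := map_injective (P ⊔ Q).subtype_injective
  have h := lowerCentralSeries_sup_eq_bot_of_normal (c := c) (d := d)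
    (hinj ((key P le_sup_left c).trans (by rw [hc, map_bot])))
    (hinj ((key Q le_sup_right d).trans (by rw [hd, map_bot])))
  refine ⟨c + d + 1, ?_⟩
  rw [← key _ le_rfl, subgroupOf_sup le_sup_left le_sup_right, h, map_bot]

/-! ### Finitely generated subgroups -/

theorem exists_finite_subset_of_mem_closure {T : Set G} {x : G} (hx : x ∈ closure T) :
    ∃ T' ⊆ T, T'.Finite ∧ x ∈ closure T' := by
  induction hx using closure_induction with
  | mem x hx => exact ⟨{x}, by simpa using hx, Set.finite_singleton x, mem_closure_singleton_self x⟩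
  | one => exact ⟨∅, Set.empty_subset _, Set.finite_empty, one_mem _⟩
  | mul x y _ _ ihx ihy =>
    obtain ⟨U, hU, hUf, hxU⟩ := ihx
    obtain ⟨V, hV, hVf, hyV⟩ := ihy
    exact ⟨U ∪ V, Set.union_subset hU hV, hUf.union hVf,
      mul_mem (closure_mono Set.subset_union_left hxU) (closure_mono Set.subset_union_right hyV)⟩
  | inv x _ ih =>
    obtain ⟨U, hU, hUf, hxU⟩ := ih
    exact ⟨U, hU, hUf, inv_mem hxU⟩

theorem FG.exists_finite_subset_of_le_closure {T : Set G} {F : Subgroup G} (hF : F.FG)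
    (hFT : F ≤ closure T) : ∃ T' ⊆ T, T'.Finite ∧ F ≤ closure T' := by
  obtain ⟨S, rfl⟩ := hF
  choose! U hUT hUf hU using fun x (hx : x ∈ closure T) => exists_finite_subset_of_mem_closure hx
  have hS : ∀ x ∈ S, x ∈ closure T := fun x hx => hFT (subset_closure hx)
  refine ⟨⋃ x ∈ S, U x, Set.iUnion₂_subset fun x hx => hUT x (hS x hx),
    S.finite_toSet.biUnion fun x hx => hUf x (hS x hx), (closure_le _).2 fun x hx => ?_⟩
  exact closure_mono (Set.subset_biUnion_of_mem (u := U) hx) (hU x (hS x hx))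

theorem fg_closure_of_finite {T : Set G} (hT : T.Finite) : (closure T).FG :=
  (fg_iff _).2 ⟨T, rfl, hT⟩

theorem closure_le_normalizer_closure {S T : Set G} (hS : ∀ s ∈ S, s⁻¹ ∈ S)
    (h : ∀ s ∈ S, ∀ t ∈ T, s * t * s⁻¹ ∈ closure T) : closure S ≤ normalizer (closure T) := by
  have h' : ∀ s ∈ S, ∀ t ∈ closure T, s * t * s⁻¹ ∈ closure T := by
    intro s hs
    suffices closure T ≤ (closure T).comap (MulAut.conj s).toMonoidHom from fun t ht => by
      simpa using this ht
    exact (closure_le _).2 fun t ht => by simpa using h s hs t ht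
  refine (closure_le _).2 fun s hs t => ⟨h' s hs t, fun ht => ?_⟩
  simpa [mul_assoc] using h' _ (hS s hs) _ ht

/-! ### The Hirsch–Plotkin theorem -/

/-- The set of iterated commutators `⁅s₁, ⁅s₂, …, ⁅sₙ, c⁆⁆⁆` with `sᵢ ∈ S` and `c ∈ C`. -/
def iteratedCommutatorSet (S C : Set G) : ℕ → Set G
  | 0 => C
  | n + 1 => Set.image2 (fun s t => ⁅s, t⁆) S (iteratedCommutatorSet S C n)

theorem iteratedCommutatorSet_finite {S C : Set G} (hS : S.Finite) (hC : C.Finite) :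
    ∀ n, (iteratedCommutatorSet S C n).Finite
  | 0 => hC
  | n + 1 => hS.image2 _ (iteratedCommutatorSet_finite hS hC n)

theorem iteratedCommutatorSet_subset_lowerCentralSeries (S C : Set G) :
    ∀ n, iteratedCommutatorSet S C n ⊆ (closure (S ∪ C)).lowerCentralSeries n
  | 0 => Set.subset_union_right.trans subset_closure
  | n + 1 => by
    rintro _ ⟨s, hs, t, ht, rfl⟩
    rw [lowerCentralSeries_succ, commutator_comm]
    exact commutator_mem_commutator (subset_closure (Or.inl hs))
      (iteratedCommutatorSet_subset_lowerCentralSeries S C n ht)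

theorem iteratedCommutatorSet_subset {S C : Set G} {R : Subgroup G} (hC : C ⊆ R)
    (hS : S ⊆ normalizer (R : Set G)) : ∀ n, iteratedCommutatorSet S C n ⊆ R
  | 0 => hC
  | n + 1 => by
    rintro _ ⟨s, hs, t, ht, rfl⟩
    have ht := iteratedCommutatorSet_subset hC hS n ht
    exact mul_mem ((hS hs t).1 ht) (inv_mem ht)

/-- In a nilpotent group generated by finite sets `S` and `C`, the closure of `C` under conjugation
by `S` generates a finitely generated subgroup. -/
theorem exists_fg_le_normalizer {S C : Set G} (hSf : S.Finite) (hCf : C.Finite)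
    (hS : ∀ s ∈ S, s⁻¹ ∈ S) (hnil : ∃ n, (closure (S ∪ C)).lowerCentralSeries n = ⊥) :
    ∃ T : Set G, T.Finite ∧ C ⊆ T ∧ closure S ≤ normalizer (closure T) ∧
      ∀ R : Subgroup G, C ⊆ R → S ⊆ normalizer (R : Set G) → T ⊆ R := by
  obtain ⟨n, hn⟩ := hnil
  refine ⟨⋃ k, iteratedCommutatorSet S C k, ?_, Set.subset_iUnion (iteratedCommutatorSet S C) 0,
    closure_le_normalizer_closure hS ?_,
    fun R hC hS => Set.iUnion_subset (iteratedCommutatorSet_subset hC hS)⟩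
  -- By nilpotency, commutators of depth at least `n` are trivial.
  · refine Set.Finite.subset (s := (⋃ k ∈ Set.Iio n, iteratedCommutatorSet S C k) ∪ {1})
      (((Set.finite_Iio n).biUnion fun k _ => iteratedCommutatorSet_finite hSf hCf k).union
        (Set.finite_singleton 1)) (Set.iUnion_subset fun k x hx => ?_)
    rcases lt_or_ge k n with hk | hk
    · exact Or.inl (Set.mem_biUnion hk hx)
    · have := lowerCentralSeries_antitone _ hk
        (iteratedCommutatorSet_subset_lowerCentralSeries S C k hx)
      rw [hn] at this
      exact Or.inr this
  · intro s hs t ht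
    obtain ⟨k, hk⟩ := Set.mem_iUnion.1 ht
    have h1 : ⁅s, t⁆ ∈ closure (⋃ k, iteratedCommutatorSet S C k) :=
      subset_closure (Set.mem_iUnion.2 ⟨k + 1, s, hs, t, hk, rfl⟩)
    simpa [commutatorElement_def] using mul_mem h1 (subset_closure ht)

/-- A subgroup all of whose finitely generated subgroups are nilpotent. -/
def IsLocallyNilpotent (H : Subgroup G) : Prop :=
  ∀ F ≤ H, F.FG → ∃ n, F.lowerCentralSeries n = ⊥

theorem exists_lowerCentralSeries_eq_bot_of_le {H K : Subgroup G} (hHK : H ≤ K)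
    (hK : ∃ n, K.lowerCentralSeries n = ⊥) : ∃ n, H.lowerCentralSeries n = ⊥ :=
  hK.imp fun n hn => le_bot_iff.1 ((lowerCentralSeries_mono n hHK).trans hn.le)

theorem IsLocallyNilpotent.mono {H K : Subgroup G} (hHK : H ≤ K) (hK : K.IsLocallyNilpotent) :
    H.IsLocallyNilpotent :=
  fun F hF => hK F (hF.trans hHK)

theorem isLocallyNilpotent_of_lowerCentralSeries_eq_bot {H : Subgroup G}
    (hH : ∃ n, H.lowerCentralSeries n = ⊥) : H.IsLocallyNilpotent :=
  fun _ hF _ => exists_lowerCentralSeries_eq_bot_of_le hF hH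

theorem IsLocallyNilpotent.map_conj {H : Subgroup G} (hH : H.IsLocallyNilpotent) (g : G) :
    (H.map (MulAut.conj g).toMonoidHom).IsLocallyNilpotent := by
  intro F hF hFG
  obtain ⟨S, rfl⟩ := hFG
  obtain ⟨n, hn⟩ := hH ((closure S).map (MulAut.conj g⁻¹).toMonoidHom) (by
      rintro _ ⟨x, hx, rfl⟩
      obtain ⟨y, hy, rfl⟩ := hF hx
      simpa [mul_assoc] using hy)
    (by
      rw [MonoidHom.map_closure]
      exact fg_closure_of_finite (S.finite_toSet.image _))
  rw [← map_lowerCentralSeries, map_eq_bot_iff_of_injective _ (MulAut.conj g⁻¹).injective] at hn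
  exact ⟨n, hn⟩

/-- The commutators `⁅x, y⁆` lie in `H ⊓ K`. Together with `X` they generate a nilpotent subgroup of
`H`, so finitely many elements `T` generate an `X`-invariant subgroup containing them. Adjoining `Y`
preserves invariance, since `x * y * x⁻¹ = ⁅x, y⁆ * y`. -/
theorem exists_fg_between_of_le_normalizer {H K : Subgroup G} (hHK : H ≤ normalizer K)
    (hKH : K ≤ normalizer H) (hH : H.IsLocallyNilpotent) {X Y : Set G} (hXf : X.Finite)
    (hYf : Y.Finite) (hXinv : ∀ x ∈ X, x⁻¹ ∈ X) (hX : X ⊆ H) (hY : Y ⊆ K) :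
    ∃ P : Subgroup G, P.FG ∧ closure Y ≤ P ∧ P ≤ K ∧ P ≤ closure X ⊔ closure Y ∧
      closure X ≤ normalizer P := by
  set C : Set G := Set.image2 (fun x y => ⁅x, y⁆) X Y
  have hCf : C.Finite := hXf.image2 _ hYf
  have hCH : C ⊆ H := by
    rintro _ ⟨x, hx, y, hy, rfl⟩
    have := mul_mem (hX hx) ((hKH (hY hy) _).1 (inv_mem (hX hx)))
    simpa [commutatorElement_def, mul_assoc] using this
  have hCK : C ⊆ K := by
    rintro _ ⟨x, hx, y, hy, rfl⟩
    exact mul_mem ((hHK (hX hx) _).1 (hY hy)) (inv_mem (hY hy))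
  have hCXY : C ⊆ (closure X ⊔ closure Y : Subgroup G) := by
    rintro _ ⟨x, hx, y, hy, rfl⟩
    exact commutator_le_sup _ _
      (commutator_mem_commutator (subset_closure hx) (subset_closure hy))
  obtain ⟨T, hTf, hCT, hXT, hT⟩ := exists_fg_le_normalizer hXf hCf hXinv
    (hH _ ((closure_le _).2 (Set.union_subset hX hCH)) (fg_closure_of_finite (hXf.union hCf)))
  refine ⟨closure (Y ∪ T), fg_closure_of_finite (hYf.union hTf),
    closure_mono Set.subset_union_left,
    (closure_le _).2 (Set.union_subset hY (hT K hCK (hX.trans hHK))),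
    (closure_le _).2 (Set.union_subset (subset_closure.trans ?_) (hT _ hCXY ?_)),
    closure_le_normalizer_closure hXinv ?_⟩
  · exact SetLike.coe_subset_coe.2 le_sup_right
  · exact subset_closure.trans (SetLike.coe_subset_coe.2 (le_sup_left.trans le_normalizer))
  · rintro x hx t (ht | ht)
    · have h1 : ⁅x, t⁆ ∈ closure (Y ∪ T) :=
        subset_closure (Or.inr (hCT ⟨x, hx, t, ht, rfl⟩))
      simpa [commutatorElement_def] using mul_mem h1 (subset_closure (Or.inl ht))
    · exact closure_mono Set.subset_union_right
        ((hXT (subset_closure hx) t).1 (subset_closure ht))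

/-- The **Hirsch–Plotkin theorem**: the join of two locally nilpotent subgroups which normalize each
other is locally nilpotent. -/
theorem IsLocallyNilpotent.sup {H K : Subgroup G} (hHK : H ≤ normalizer K)
    (hKH : K ≤ normalizer H) (hH : H.IsLocallyNilpotent) (hK : K.IsLocallyNilpotent) :
    (H ⊔ K).IsLocallyNilpotent := by
  intro F hF hFG
  rw [sup_eq_closure] at hF
  obtain ⟨S, hS, hSf, hFS⟩ := hFG.exists_finite_subset_of_le_closure hF
  set X : Set G := (S ∪ S⁻¹) ∩ H
  set Y : Set G := (S ∪ S⁻¹) ∩ K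
  have hXf : X.Finite := (hSf.union hSf.inv).inter_of_left _
  have hYf : Y.Finite := (hSf.union hSf.inv).inter_of_left _
  have hinv (L : Subgroup G) : ∀ x ∈ (S ∪ S⁻¹) ∩ (L : Set G), x⁻¹ ∈ (S ∪ S⁻¹) ∩ (L : Set G) := by
    rintro x ⟨hx, hxL⟩
    exact ⟨by simpa [or_comm] using hx, inv_mem hxL⟩
  have hSXY : closure S ≤ closure X ⊔ closure Y := by
    refine (closure_le _).2 fun s hs => ?_
    rcases hS hs with h | h
    · exact mem_sup_left (subset_closure ⟨Or.inl hs, h⟩)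
    · exact mem_sup_right (subset_closure ⟨Or.inl hs, h⟩)
  -- `P ≤ K` and `Q ≤ H` are finitely generated, hence nilpotent. Both lie in `⟨X, Y⟩`, which
  -- normalizes each of them, so Fitting's theorem applies to `P ⊔ Q`.
  obtain ⟨P, hPf, hYP, hPK, hPXY, hXP⟩ := exists_fg_between_of_le_normalizer hHK hKH hH hXf hYf
    (hinv H) Set.inter_subset_right Set.inter_subset_right
  obtain ⟨Q, hQf, hXQ, hQH, hQXY, hYQ⟩ := exists_fg_between_of_le_normalizer hKH hHK hK hYf hXf
    (hinv K) Set.inter_subset_right Set.inter_subset_right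
  refine exists_lowerCentralSeries_eq_bot_of_le (hFS.trans (hSXY.trans (sup_comm P Q ▸
    sup_le_sup hXQ hYP))) (exists_lowerCentralSeries_sup_eq_bot ?_ ?_ (hK P hPK hPf) (hH Q hQH hQf))
  · exact hPXY.trans (sup_le (hXQ.trans le_normalizer) hYQ)
  · exact hQXY.trans (sup_le (hYP.trans le_normalizer) hXP)

theorem le_normalizer_finset_sup {ι : Type*} {H : ι → Subgroup G} {R : Subgroup G}
    (h : ∀ i, R ≤ normalizer (H i)) (s : Finset ι) : R ≤ normalizer (s.sup H : Subgroup G) := by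
  classical
  induction s using Finset.induction_on with
  | empty => exact le_normalizer_iff.2 fun r _ k hk => by simp_all
  | insert a s _ ih =>
    rw [Finset.sup_insert]
    exact (le_inf (h a) ih).trans (normalizer_inf_normalizer_le_normalizer_sup _ _)

/-- A finitely generated subgroup of the join lies in a finite subjoin, where Hirsch–Plotkin applies
inductively. -/
theorem isLocallyNilpotent_iSup {ι : Type*} {H : ι → Subgroup G}
    (hnorm : ∀ i j, H i ≤ normalizer (H j)) (hH : ∀ i, (H i).IsLocallyNilpotent) :
    (⨆ i, H i).IsLocallyNilpotent := by
  classical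
  have hfin (s : Finset ι) : (s.sup H).IsLocallyNilpotent := by
    induction s using Finset.induction_on with
    | empty =>
      refine isLocallyNilpotent_of_lowerCentralSeries_eq_bot ⟨0, ?_⟩
      rw [Finset.sup_empty, lowerCentralSeries_zero]
    | insert a s _ ih =>
      rw [Finset.sup_insert]
      exact (hH a).sup (le_normalizer_finset_sup (fun i => hnorm a i) s)
        (Finset.sup_le fun i _ => hnorm i a) ih
  rcases isEmpty_or_nonempty ι with _ | _
  · exact (hfin ∅).mono (by simp)
  intro F hF hFG
  rw [iSup_eq_closure] at hF
  obtain ⟨S, hS, hSf, hFS⟩ := hFG.exists_finite_subset_of_le_closure hF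
  choose! i hi using fun x (hx : x ∈ S) => Set.mem_iUnion.1 (hS hx)
  refine hfin (hSf.toFinset.image i) F (hFS.trans ((closure_le _).2 fun x hx => ?_)) hFG
  exact Finset.le_sup (f := H) (Finset.mem_image_of_mem i (hSf.mem_toFinset.2 hx)) (hi x hx)

end Subgroup

namespace Subgroup

variable {G : Type*} [Group G]

/-! ### Stability groups of a descending series -/

/-- The series `N`, `⁅M, N⁆`, `⁅M, ⁅M, N⁆⁆`, …. -/
def commutatorSeries (M N : Subgroup G) : ℕ → Subgroup G
  | 0 => N
  | n + 1 => ⁅M, commutatorSeries M N n⁆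

variable {M N : Subgroup G}

theorem commutatorSeries_le_normalizer_succ (M N : Subgroup G) (i : ℕ) :
    commutatorSeries M N i ≤ normalizer (commutatorSeries M N (i + 1)) :=
  normalizer_commutator_ge_right _ _

theorem le_normalizer_commutatorSeries (hMN : M ≤ normalizer N) :
    ∀ i, M ≤ normalizer (commutatorSeries M N i)
  | 0 => hMN
  | _ + 1 => normalizer_commutator_ge_left _ _

theorem commutatorSeries_antitone (hMN : M ≤ normalizer N) : Antitone (commutatorSeries M N) :=
  antitone_nat_of_succ_le fun i =>
    le_normalizer_iff_commutator_le_right.1 (le_normalizer_commutatorSeries hMN i)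

/-- The elements of `M` which centralize the term `i + 1` of the commutator series and map the
term `i` into the term `i + 1 + j`. -/
def seriesStabilizer (M N : Subgroup G) (i j : ℕ) : Subgroup G where
  carrier := {k | k ∈ M ∧ k ∈ centralizer (commutatorSeries M N (i + 1) : Set G) ∧
    ∀ g ∈ commutatorSeries M N i, ⁅k, g⁆ ∈ commutatorSeries M N (i + 1 + j)}
  one_mem' := ⟨one_mem _, one_mem _, fun g _ => by simp⟩
  mul_mem' := by
    rintro k l ⟨hk, hkc, hkg⟩ ⟨hl, hlc, hlg⟩
    refine ⟨mul_mem hk hl, mul_mem hkc hlc, fun g hg => ?_⟩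
    -- `k` centralizes the next term, which contains `⁅l, g⁆`; the conjugation in the product
    -- formula for commutators therefore disappears.
    have h : k * ⁅l, g⁆ * k⁻¹ = ⁅l, g⁆ := by
      rw [← mem_centralizer_iff.1 hkc _ (commutator_mem_commutator hl hg), mul_inv_cancel_right]
    rw [commutatorElement_mul_left_eq_conj_mul, h]
    exact mul_mem (hlg g hg) (hkg g hg)
  inv_mem' := by
    rintro k ⟨hk, hkc, hkg⟩
    refine ⟨inv_mem hk, inv_mem hkc, fun g hg => ?_⟩
    have h : k⁻¹ * ⁅k, g⁆⁻¹ * k = ⁅k, g⁆⁻¹ := by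
      rw [mul_assoc, mem_centralizer_iff.1 hkc _ (inv_mem (commutator_mem_commutator hk hg)),
        inv_mul_cancel_left]
    rw [commutatorElement_inv_left, ← commutatorElement_inv, h]
    exact inv_mem (hkg g hg)

theorem conj_mem_centralizer {H : Subgroup G} {m k : G} (hm : m ∈ normalizer (H : Set G))
    (hk : k ∈ centralizer (H : Set G)) : m * k * m⁻¹ ∈ centralizer (H : Set G) := by
  refine mem_centralizer_iff.2 fun h hh => ?_
  have h1 : m⁻¹ * h * m ∈ H := by simpa using (inv_mem hm h).1 hh
  have h2 := mem_centralizer_iff.1 hk _ h1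
  calc h * (m * k * m⁻¹) = m * (m⁻¹ * h * m * k) * m⁻¹ := by group
    _ = m * k * m⁻¹ * h := by rw [h2]; group

/-- If `k` centralizes the next term of the series, then conjugating `k` by an element of `M`
conjugates the values of `g ↦ ⁅k, g⁆`. -/
theorem commutatorElement_conj_eq_conj {i : ℕ} {k m g : G} (hm : m ∈ M)
    (hkc : k ∈ centralizer (commutatorSeries M N (i + 1) : Set G))
    (hg : g ∈ commutatorSeries M N i) :
    ⁅m * k * m⁻¹, g⁆ = m * ⁅k, g⁆ * m⁻¹ := by
  -- `⁅k, g⁆ = k * (g * k⁻¹ * g⁻¹)`, and `g` normalizes the next term, hence also its centralizer.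
  have hcent : ⁅k, g⁆ ∈ centralizer (commutatorSeries M N (i + 1) : Set G) := by
    have := mul_mem hkc (conj_mem_centralizer (commutatorSeries_le_normalizer_succ M N i hg)
      (inv_mem hkc))
    simpa [commutatorElement_def, mul_assoc] using this
  have hh : ⁅m⁻¹, g⁆ ∈ commutatorSeries M N (i + 1) :=
    commutator_mem_commutator (inv_mem hm) hg
  have h1 : ⁅k, ⁅m⁻¹, g⁆⁆ = 1 :=
    commutatorElement_eq_one_iff_mul_comm.2 (mem_centralizer_iff.1 hkc _ hh).symm
  have h2 : ⁅m⁻¹, g⁆ * ⁅k, g⁆ * ⁅m⁻¹, g⁆⁻¹ = ⁅k, g⁆ := by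
    rw [mem_centralizer_iff.1 hcent _ hh, mul_inv_cancel_right]
  calc ⁅m * k * m⁻¹, g⁆ = m * ⁅k, ⁅m⁻¹, g⁆ * g⁆ * m⁻¹ := by
        simp only [commutatorElement_def]; group
    _ = m * (⁅k, ⁅m⁻¹, g⁆⁆ * ⁅m⁻¹, g⁆ * ⁅k, g⁆ * ⁅m⁻¹, g⁆⁻¹) * m⁻¹ := by
        rw [commutatorElement_mul_right_eq_mul_conj]
    _ = m * ⁅k, g⁆ * m⁻¹ := by rw [h1, one_mul, h2]

/-- The point is the identity `⁅⁅k, m⁆, g⁆ = ⁅m, ⁅k, g⁆⁻¹⁆`, whose right side lies one term further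
down. -/
theorem commutator_seriesStabilizer_le (M N : Subgroup G) (i j : ℕ) :
    ⁅seriesStabilizer M N i j, M⁆ ≤ seriesStabilizer M N i (j + 1) := by
  rw [commutator_le]
  rintro k ⟨hk, hkc, hkg⟩ m hm
  have hk' := inv_mem hk
  have hkc' := inv_mem hkc
  have hmn : m ∈ normalizer (commutatorSeries M N (i + 1) : Set G) :=
    normalizer_commutator_ge_left _ _ hm
  have hc := conj_mem_centralizer hmn hkc'
  have heq : ⁅k, m⁆ = k * (m * k⁻¹ * m⁻¹) := by simp [commutatorElement_def, mul_assoc]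
  refine ⟨?_, heq ▸ mul_mem hkc hc, fun g hg => ?_⟩
  · rw [heq]
    exact mul_mem hk (mul_mem (mul_mem hm hk') (inv_mem hm))
  · set d := ⁅k, g⁆ with hd
    have hdi : ⁅k⁻¹, g⁆ = d⁻¹ := by
      rw [commutatorElement_inv_left, ← commutatorElement_inv, mul_assoc,
        mem_centralizer_iff.1 hkc _ (inv_mem (commutator_mem_commutator hk hg)),
        inv_mul_cancel_left]
    have hval : ⁅m * k⁻¹ * m⁻¹, g⁆ = m * d⁻¹ * m⁻¹ := by
      rw [commutatorElement_conj_eq_conj hm hkc' hg, hdi]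
    have hmem : m * d⁻¹ * m⁻¹ ∈ commutatorSeries M N (i + 1) :=
      (hmn _).1 (inv_mem (commutator_mem_commutator hk hg))
    have hfin : ⁅⁅k, m⁆, g⁆ = ⁅m, d⁻¹⁆ := by
      rw [heq, commutatorElement_mul_left_eq_conj_mul, hval,
        ← mem_centralizer_iff.1 hkc _ hmem, mul_inv_cancel_right, ← hd,
        commutatorElement_def, inv_inv]
    rw [hfin]
    exact commutator_mem_commutator hm (inv_mem (hkg g hg))

/-- **Hall's theorem**: if `⁅M, ⁅M, …, ⁅M, N⁆⁆⁆` vanishes, then `M` is nilpotent modulo the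
centralizer of `N`. -/
theorem exists_lowerCentralSeries_le_centralizer {n : ℕ} (hn : commutatorSeries M N n = ⊥) :
    ∃ c, M.lowerCentralSeries c ≤ centralizer (N : Set G) := by
  suffices ∀ j ≤ n, ∃ c, M.lowerCentralSeries c ≤
      centralizer (commutatorSeries M N (n - j) : Set G) by
    simpa [commutatorSeries] using this n le_rfl
  intro j
  induction j with
  | zero =>
    refine fun _ => ⟨0, fun x _ => ?_⟩
    rw [Nat.sub_zero, hn]
    simp [mem_centralizer_iff]
  | succ j ih =>
    intro hj
    obtain ⟨c, hc⟩ := ih (by omega)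
    obtain ⟨i, rfl⟩ : ∃ i, n = i + 1 + j := ⟨n - (j + 1), by omega⟩
    rw [show i + 1 + j - j = i + 1 by omega] at hc
    rw [show i + 1 + j - (j + 1) = i by omega]
    -- Once term `i + 1` is centralized, `j` further commutators with `M` push `⁅k, g⁆` into term `i
    -- + 1 + j = n`, which is trivial.
    have hle : ∀ l, M.lowerCentralSeries (c + l) ≤ seriesStabilizer M N i l := by
      intro l
      induction l with
      | zero => exact fun k hk => ⟨lowerCentralSeries_le_self M c hk, hc hk, fun g hg =>
          commutator_mem_commutator (lowerCentralSeries_le_self M c hk) hg⟩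
      | succ l ihl =>
        exact (commutator_mono ihl le_rfl).trans (commutator_seriesStabilizer_le M N i l)
    refine ⟨c + j, fun k hk => mem_centralizer_iff.2 fun g hg => ?_⟩
    have := (hle j hk).2.2 g hg
    rw [hn, mem_bot, commutatorElement_eq_one_iff_mul_comm] at this
    exact this.symm

/-! ### Local nilpotence of `⁅M, N⁆ M` -/

theorem commutatorSeries_le_normalizer_sup (M N : Subgroup G) (i : ℕ) :
    commutatorSeries M N i ≤ normalizer (commutatorSeries M N (i + 1) ⊔ M : Subgroup G) := by
  rw [le_normalizer_iff_commutator_le_left, commutator_comm]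
  refine commutator_le.2 fun g hg => ?_
  have hle : commutatorSeries M N (i + 1) ⊔ M ≤
      (commutatorSeries M N (i + 1) ⊔ M).comap (MulAut.conj g).toMonoidHom := by
    refine sup_le (fun x hx => ?_) fun m hm => ?_
    · simpa using mem_sup_left ((commutatorSeries_le_normalizer_succ M N i hg x).1 hx)
    · have h1 : ⁅m, g⁆⁻¹ ∈ commutatorSeries M N (i + 1) :=
        inv_mem (commutator_mem_commutator hm hg)
      simpa [commutatorElement_def, mul_assoc] using mul_mem_sup h1 hm
  intro x hx
  exact mul_mem (by simpa using hle hx) (inv_mem hx)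

theorem isLocallyNilpotent_commutatorSeries_sup {n : ℕ} (hMN : M ≤ normalizer N)
    (hn : commutatorSeries M N n = ⊥) (hM : ∃ c, M.lowerCentralSeries c = ⊥) :
    (commutatorSeries M N 1 ⊔ M).IsLocallyNilpotent := by
  -- Passing from term `i + 2` to term `i + 1` conjugates by term `i`, so the climb stops at term
  -- `1`.
  suffices ∀ j ≤ n, (commutatorSeries M N (n + 1 - j) ⊔ M).IsLocallyNilpotent by
    simpa using this n le_rfl
  intro j
  induction j with
  | zero =>
    intro _
    have : commutatorSeries M N (n + 1) = ⊥ :=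
      le_bot_iff.1 ((commutatorSeries_antitone hMN n.le_succ).trans hn.le)
    rw [Nat.sub_zero, this, bot_sup_eq]
    exact isLocallyNilpotent_of_lowerCentralSeries_eq_bot hM
  | succ j ih =>
    intro hj
    obtain ⟨i, rfl⟩ : ∃ i, n = i + 1 + j := ⟨n - (j + 1), by omega⟩
    have ih := ih (by omega)
    rw [show i + 1 + j + 1 - j = i + 2 by omega] at ih
    rw [show i + 1 + j + 1 - (j + 1) = i + 1 by omega]
    set B : ℕ → Subgroup G := fun i => commutatorSeries M N i ⊔ M
    have hBn : B (i + 1) ≤ normalizer (B (i + 2) : Set G) :=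
      sup_le (commutatorSeries_le_normalizer_sup M N (i + 1)) (le_sup_right.trans le_normalizer)
    have hconj (g : commutatorSeries M N i) :
        (B (i + 1)).map (MulAut.conj (g : G)).toMonoidHom = B (i + 1) :=
      mem_normalizer_iff_map_conj_eq.1 (commutatorSeries_le_normalizer_sup M N i g.2)
    have hsub : B (i + 2) ≤ B (i + 1) :=
      sup_le_sup_right (commutatorSeries_antitone hMN (Nat.le_succ _)) _
    set H : commutatorSeries M N i → Subgroup G :=
      fun g => (B (i + 2)).map (MulAut.conj (g : G)).toMonoidHom
    refine IsLocallyNilpotent.mono (K := ⨆ g, H g) ?_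
      (isLocallyNilpotent_iSup (fun g h => ?_) fun g => ih.map_conj g)
    -- `⁅m, g⁆ = m * (g * m⁻¹ * g⁻¹)` is a product of elements of `M` and of a conjugate of `M`.
    · have hMH (g : commutatorSeries M N i) (m : G) (hm : m ∈ M) :
          (g : G) * m * (g : G)⁻¹ ∈ ⨆ g, H g :=
        mem_iSup_of_mem g ⟨m, mem_sup_right hm, by simp⟩
      have hM' : M ≤ ⨆ g, H g := fun m hm => by simpa using hMH 1 m hm
      refine sup_le (commutator_le.2 fun m hm g hg => ?_) hM'
      simpa [commutatorElement_def, mul_assoc] using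
        mul_mem (hM' hm) (hMH ⟨g, hg⟩ _ (inv_mem hm))
    -- Both conjugates lie in `B (i + 1)`, which is invariant under conjugation by `g` and `h` and
    -- normalizes `B (i + 2)`.
    · calc H g ≤ (B (i + 1)).map (MulAut.conj (g : G)).toMonoidHom := map_mono hsub
        _ = (B (i + 1)).map (MulAut.conj (h : G)).toMonoidHom := by rw [hconj, hconj]
        _ ≤ (normalizer (B (i + 2) : Set G)).map (MulAut.conj (h : G)).toMonoidHom := map_mono hBn
        _ ≤ normalizer (H h) := le_normalizer_map _

end Subgroup

/-! ### The brace as a group of permutations -/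

namespace SkewLeftBrace

variable (A : Type*) [SkewLeftBrace A]

/-- The left regular representation of `(A, +)`. -/
def translationHom : Multiplicative A →* Equiv.Perm A where
  toFun x := Equiv.addLeft x.toAdd
  map_one' := by ext; simp
  map_mul' x y := by ext; simp

/-- The homomorphism `λ`, with values in the permutations of `A`. -/
def lamPerm : A →* Equiv.Perm A where
  toFun a := (lamAut a).toEquiv
  map_one' := by ext b; exact lam_one_aux A b
  map_mul' a b := by ext c; exact lam_mul_aux A a b c

theorem ker_lamPerm : (lamPerm A).ker = (lam A).ker := by
  ext a
  rw [MonoidHom.mem_ker, MonoidHom.mem_ker]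
  constructor
  · intro h
    apply Multiplicative.toAdd.injective
    exact AddEquiv.ext fun b => congrArg (fun e : Equiv.Perm A => e b) h
  · intro h
    ext b
    exact congrArg (fun e : Multiplicative (AddAut A) => e.toAdd b) h

variable {A}

@[simp]
theorem translationHom_ofAdd_apply (x b : A) :
    translationHom A (Multiplicative.ofAdd x) b = x + b := rfl

@[simp]
theorem lamPerm_apply (a b : A) : lamPerm A a b = lamAut a b := rfl

theorem translationHom_injective : Function.Injective (translationHom A) := by
  intro x y h
  simpa [translationHom] using congrArg (fun e : Equiv.Perm A => e 0) h

theorem lamPerm_mul_translationHom_mul_inv (a x : A) :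
    lamPerm A a * translationHom A (Multiplicative.ofAdd x) * (lamPerm A a)⁻¹ =
      translationHom A (Multiplicative.ofAdd (lamAut a x)) := by
  rw [mul_inv_eq_iff_eq_mul]
  ext b
  simp

theorem commutatorElement_lamPerm_translationHom (a x : A) :
    ⁅lamPerm A a, translationHom A (Multiplicative.ofAdd x)⁆ =
      translationHom A (Multiplicative.ofAdd (star a x)) := by
  rw [commutatorElement_def, lamPerm_mul_translationHom_mul_inv, ← map_inv, ← map_mul, ← ofAdd_neg,
    ← ofAdd_add, star, sub_eq_add_neg]

variable (A)

theorem commutatorSeries_eq_map_leftSeries (n : ℕ) :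
    Subgroup.commutatorSeries (lamPerm A).range (translationHom A).range n =
      (AddSubgroup.toSubgroup (leftSeries A n)).map (translationHom A) := by
  induction n with
  | zero => exact MonoidHom.range_eq_map _
  | succ n ih =>
    rw [Subgroup.commutatorSeries, ih]
    apply le_antisymm
    · rw [Subgroup.commutator_le]
      rintro _ ⟨a, rfl⟩ _ ⟨x, hx, rfl⟩
      refine ⟨Multiplicative.ofAdd (star a x.toAdd), ?_,
        (commutatorElement_lamPerm_translationHom a x.toAdd).symm⟩
      change star a x.toAdd ∈ leftSeries A (n + 1)
      exact AddSubgroup.subset_closure ⟨a, Set.mem_univ a, x.toAdd, hx, rfl⟩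
    · rw [Subgroup.map_le_iff_le_comap]
      suffices leftSeries A (n + 1) ≤ Subgroup.toAddSubgroup' (Subgroup.comap (translationHom A)
          ⁅(lamPerm A).range, (AddSubgroup.toSubgroup (leftSeries A n)).map (translationHom A)⁆) from
        fun x hx => this hx
      refine (AddSubgroup.closure_le _).2 ?_
      rintro _ ⟨a, -, x, hx, rfl⟩
      change translationHom A (Multiplicative.ofAdd (star a x)) ∈
        ⁅(lamPerm A).range, (AddSubgroup.toSubgroup (leftSeries A n)).map (translationHom A)⁆
      rw [← commutatorElement_lamPerm_translationHom]
      exact Subgroup.commutator_mem_commutator ⟨a, rfl⟩ ⟨_, hx, rfl⟩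

theorem range_lamPerm_le_normalizer :
    (lamPerm A).range ≤ Subgroup.normalizer ((translationHom A).range : Set (Equiv.Perm A)) := by
  rw [Subgroup.le_normalizer_iff]
  rintro _ ⟨a, rfl⟩ _ ⟨x, rfl⟩
  exact ⟨_, (lamPerm_mul_translationHom_mul_inv a x.toAdd).symm⟩

/-- A permutation commuting with all translations is determined by its value at `0`, and `λ_a` fixes
`0`. -/
theorem disjoint_range_lamPerm_centralizer :
    Disjoint (lamPerm A).range
      (Subgroup.centralizer ((translationHom A).range : Set (Equiv.Perm A))) := by
  rw [Subgroup.disjoint_def]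
  rintro _ ⟨a, rfl⟩ h
  ext x
  have h1 := Subgroup.mem_centralizer_iff.1 h _ ⟨Multiplicative.ofAdd x, rfl⟩
  have h2 := congrArg (fun e : Equiv.Perm A => e 0) h1
  simpa using h2.symm

variable {A}

theorem exists_lowerCentralSeries_range_lamPerm_eq_bot (hA : IsLeftNilpotent A) :
    ∃ c, (lamPerm A).range.lowerCentralSeries c = ⊥ := by
  obtain ⟨n, hn⟩ := hA
  obtain ⟨c, hc⟩ := Subgroup.exists_lowerCentralSeries_le_centralizer (n := n)
    (M := (lamPerm A).range) (N := (translationHom A).range)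
    (by rw [commutatorSeries_eq_map_leftSeries, hn]; simp)
  exact ⟨c, le_bot_iff.1 ((disjoint_range_lamPerm_centralizer A)
    (Subgroup.lowerCentralSeries_le_self _ c) hc)⟩

theorem isLocallyNilpotent_map_leftSeries_one (hA : IsLeftNilpotent A) :
    ((AddSubgroup.toSubgroup (leftSeries A 1)).map (translationHom A)).IsLocallyNilpotent := by
  have hM := exists_lowerCentralSeries_range_lamPerm_eq_bot hA
  obtain ⟨n, hn⟩ := hA
  rw [← commutatorSeries_eq_map_leftSeries]
  refine (Subgroup.isLocallyNilpotent_commutatorSeries_sup (n := n) (range_lamPerm_le_normalizer A)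
    ?_ hM).mono le_sup_left
  rw [commutatorSeries_eq_map_leftSeries, hn]
  simp

end SkewLeftBrace

/-! ### Transfer back to the brace -/

theorem AddSubgroup.toSubgroup_lowerCentralSeries {A : Type*} [AddGroup A] (H : AddSubgroup A)
    (n : ℕ) : AddSubgroup.toSubgroup (H.lowerCentralSeries n) ≤
      (AddSubgroup.toSubgroup H).lowerCentralSeries n := by
  induction n with
  | zero => exact le_rfl
  | succ n ih =>
    suffices H.lowerCentralSeries (n + 1) ≤
        Subgroup.toAddSubgroup' ((AddSubgroup.toSubgroup H).lowerCentralSeries (n + 1)) from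
      fun x hx => this hx
    refine AddSubgroup.addCommutator_le.2 fun x hx y hy => ?_
    exact Subgroup.commutator_mem_commutator (g₁ := Multiplicative.ofAdd x)
      (g₂ := Multiplicative.ofAdd y) (ih hx) hy

/-- For a left nilpotent skew left brace `A`, the additive group of `A^2` (which is
`leftSeries A 1`) is locally nilpotent, and so is the quotient of the multiplicative group of `A`
by the kernel of `λ`. -/
theorem mainTheorem9 (A : Type*) [SkewLeftBrace A] (hA : SkewLeftBrace.IsLeftNilpotent A) :
    IsLocallyNilpotentAddGroup (SkewLeftBrace.leftSeries A 1) ∧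
      IsLocallyNilpotentGroup (A ⧸ (SkewLeftBrace.lam A).ker) := by
  constructor
  · rintro H ⟨S, rfl⟩
    set f : Multiplicative (SkewLeftBrace.leftSeries A 1) →* Equiv.Perm A :=
      (SkewLeftBrace.translationHom A).comp
        (AddMonoidHom.toMultiplicative (SkewLeftBrace.leftSeries A 1).subtype)
    have hinj : Function.Injective f :=
      SkewLeftBrace.translationHom_injective.comp Subtype.val_injective
    obtain ⟨n, hn⟩ := SkewLeftBrace.isLocallyNilpotent_map_leftSeries_one hA
      ((AddSubgroup.toSubgroup (AddSubgroup.closure (S : Set (SkewLeftBrace.leftSeries A 1)))).map f)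
      (by
        rintro _ ⟨x, -, rfl⟩
        exact ⟨_, x.toAdd.2, rfl⟩)
      (by
        rw [AddSubgroup.toSubgroup_closure, MonoidHom.map_closure]
        exact Subgroup.fg_closure_of_finite
          ((S.finite_toSet.preimage Multiplicative.toAdd.injective.injOn).image _))
    rw [← Subgroup.map_lowerCentralSeries, Subgroup.map_eq_bot_iff_of_injective _ hinj] at hn
    refine (AddSubgroup.isNilpotent_iff_lowerCentralSeries _).2 ⟨n, ?_⟩
    exact AddSubgroup.toSubgroup.injective
      (le_bot_iff.1 ((AddSubgroup.toSubgroup_lowerCentralSeries _ n).trans hn.le))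
  · intro H _
    -- The whole quotient is nilpotent, being isomorphic to the range of `lamPerm`, and nilpotency
    -- passes to subgroups.
    have h1 : Group.IsNilpotent (SkewLeftBrace.lamPerm A).range :=
      (Subgroup.isNilpotent_iff_lowerCentralSeries _).2
        (SkewLeftBrace.exists_lowerCentralSeries_range_lamPerm_eq_bot hA)
    have h2 : Group.IsNilpotent (A ⧸ (SkewLeftBrace.lam A).ker) :=
      (Group.isNilpotent_congr ((QuotientGroup.quotientMulEquivOfEq
        (SkewLeftBrace.ker_lamPerm A).symm).trans
          (QuotientGroup.quotientKerEquivRange (SkewLeftBrace.lamPerm A)))).2 h1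
    infer_instance
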